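/- Ordinary graphs are finite graphs, with loops and multiple edges allowed, described by half-edges: a graph with vertices numbered $1,\dots,n$ of valencies $d_1,\dots,d_n$ is a set of half-edges, exactly $d_k$ of which are attached to vertex $k$, with a fixed-point-free involution whose orbits are the edges. An isomorphism is a bijection of the half-edges that preserves the attaching vertices and commutes with the involutions. The genus of a connected graph is its first Betti number $\#\text{edges}-\#\text{vertices}+1$, so that a connected graph of genus $g$ satisfies $d_1+\dots+d_n=2g+2n-2$. The weighted number of connected ordinary graphs of genus $g$ with $n$ vertices of valencies $d_1,\dots,d_n$ is $$\mathrm{og}_g(d_1,\dots,d_n)=\sum_{[\Gamma]}\frac{1}{n!\,\#\mathrm{Aut}(\Gamma)},$$ the sum over isomorphism classes of connected graphs of genus $g$ with numbered vertices of valencies $d_1,\dots,d_n$. For $N\ge 1$ let $\mathbb E_N$ be the expectation over $N\times N$ Hermitian matrices $M$ with density proportional to $e^{-\frac12\operatorname{tr}M^2}$ with respect to Lebesgue measure. The connected GUE correlator is the joint cumulant $$\langle \operatorname{tr}M^{d_1}\cdots\operatorname{tr}M^{d_n}\rangle_c(N)=\sum_{\pi}(-1)^{|\pi|-1}(|\pi|-1)!\prod_{B\in\pi}\mathbb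 E_N\Big[\prod_{k\in B}\operatorname{tr}M^{d_k}\Big],$$ the sum over all set partitions $\pi$ of $\{1,\dots,n\}$. **Theorem.** Fix $n\ge 1$ and integers $i_1,\dots,i_{n-1}\ge 1$, and put $|i|=i_1+\dots+i_{n-1}$ and $i_n=i_n(g)=2g+2n-2-|i|$. Then $$\lim_{g\to\infty}\frac{i_1!\cdots i_n!\,n!}{(2g+2n-3)!!}\,\mathrm{og}_g(i_1,\dots,i_n)=1 .$$ Moreover, for all integers $n\ge1$, $g\ge 0$ and $d_1,\dots,d_n\ge 1$ with $d_1+\dots+d_n=2g+2n-2$, $$\mathrm{og}_g(d_1,\dots,d_n)=\frac{1}{d_1!\cdots d_n!\,n!}\,\langle \operatorname{tr}M^{d_1}\cdots\operatorname{tr}M^{d_n}\rangle_c(1).$$ -/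

import Mathlib

open Filter Topology

namespace OrdinaryGraphs

/-- The half-edges of a graph with `n` vertices, numbered by `Fin n`, whose vertex `k` has
valency `d k`: exactly `d k` half-edges are attached to the vertex `k`. -/
abbrev HalfEdge {n : ℕ} (d : Fin n → ℕ) : Type := (k : Fin n) × Fin (d k)

/-- An ordinary graph (loops and multiple edges are allowed) with `n` numbered vertices of
valencies `d 0, …, d (n - 1)`, presented on the half-edges `HalfEdge d`: the fixed-point-free
involution `flip` sends a half-edge to the other half of its edge. -/
@[ext]
structure OrdGraph {n : ℕ} (d : Fin n → ℕ) where
  flip : Equiv.Perm (HalfEdge d)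
  flip_flip : ∀ h, flip (flip h) = h
  flip_ne : ∀ h, flip h ≠ h

namespace OrdGraph

variable {n : ℕ} {d : Fin n → ℕ}

noncomputable instance instFintypeOrdGraph : Fintype (OrdGraph d) :=
  Fintype.ofInjective OrdGraph.flip (fun _ _ h => OrdGraph.ext h)

/-- The edges: the unordered pairs of a half-edge and its opposite half-edge. -/
def edges (Γ : OrdGraph d) : Finset (Sym2 (HalfEdge d)) :=
  Finset.univ.image fun h => s(h, Γ.flip h)

/-- The simple graph on the vertices that joins two distinct vertices if an edge joins them. -/
def toSimpleGraph (Γ : OrdGraph d) : SimpleGraph (Fin n) :=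
  SimpleGraph.fromRel fun a b => ∃ h : HalfEdge d, h.1 = a ∧ (Γ.flip h).1 = b

def Connected (Γ : OrdGraph d) : Prop := Γ.toSimpleGraph.Connected

/-- `#edges - #vertices + 1`: the genus (first Betti number) of a connected graph. -/
def genus (Γ : OrdGraph d) : ℤ := (Γ.edges.card : ℤ) - n + 1

/-- Isomorphisms of graphs with numbered vertices: they fix the vertices, permute the half-edges
at each vertex, and carry edges to edges. -/
def Iso (Γ Γ' : OrdGraph d) : Type :=
  {s : (k : Fin n) → Equiv.Perm (Fin (d k)) //
    ∀ h : HalfEdge d,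
      Equiv.sigmaCongrRight s (Γ.flip h) = Γ'.flip (Equiv.sigmaCongrRight s h)}

namespace Iso

def refl (Γ : OrdGraph d) : Iso Γ Γ := ⟨fun _ => Equiv.refl _, fun _ => rfl⟩

def symm {Γ Γ' : OrdGraph d} (s : Iso Γ Γ') : Iso Γ' Γ :=
  ⟨fun k => (s.1 k).symm, fun h => by
    apply (Equiv.sigmaCongrRight s.1).injective
    rw [s.2]
    have e : ∀ x : HalfEdge d, Equiv.sigmaCongrRight s.1
        (Equiv.sigmaCongrRight (fun k => (s.1 k).symm) x) = x := by
      rintro ⟨k, x⟩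
      simp
    rw [e, e]⟩

def trans {Γ Γ' Γ'' : OrdGraph d} (s : Iso Γ Γ') (t : Iso Γ' Γ'') : Iso Γ Γ'' :=
  ⟨fun k => (s.1 k).trans (t.1 k), fun h => by
    have e : ∀ x : HalfEdge d, Equiv.sigmaCongrRight (fun k => (s.1 k).trans (t.1 k)) x =
        Equiv.sigmaCongrRight t.1 (Equiv.sigmaCongrRight s.1 x) := by
      rintro ⟨k, x⟩
      rfl
    rw [e, e, s.2, t.2]⟩

end Iso

/-- The number of automorphisms of a graph with numbered vertices. -/
noncomputable def autCard (Γ : OrdGraph d) : ℕ := Nat.card (Iso Γ Γ)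

theorem autCard_eq_of_iso {Γ Γ' : OrdGraph d} (s : Iso Γ Γ') : Γ.autCard = Γ'.autCard := by
  refine Nat.card_congr
    ⟨fun t => s.symm.trans (t.trans s), fun t => s.trans (t.trans s.symm), ?_, ?_⟩ <;>
  · intro t
    apply Subtype.ext
    funext k
    ext x
    simp [Iso.trans, Iso.symm]

end OrdGraph

/-- The connected ordinary graphs of genus `g` with `n` numbered vertices of valencies `d`. -/
abbrev ConnGraph {n : ℕ} (g : ℕ) (d : Fin n → ℕ) : Type :=
  {Γ : OrdGraph d // Γ.Connected ∧ Γ.genus = (g : ℤ)}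

instance isoSetoid {n : ℕ} (g : ℕ) (d : Fin n → ℕ) : Setoid (ConnGraph g d) where
  r Γ Γ' := Nonempty (OrdGraph.Iso Γ.1 Γ'.1)
  iseqv :=
    ⟨fun Γ => ⟨OrdGraph.Iso.refl Γ.1⟩, fun ⟨s⟩ => ⟨s.symm⟩, fun ⟨s⟩ ⟨t⟩ => ⟨s.trans t⟩⟩

/-- The weight `1 / (n! * #Aut)` of an isomorphism class of graphs with numbered vertices; the
factor `1 / n!` compensates for the numbering of the `n` vertices. -/
noncomputable def weight {n : ℕ} (g : ℕ) (d : Fin n → ℕ) : Quotient (isoSetoid g d) → ℝ :=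
  Quotient.lift (fun Γ => 1 / ((n.factorial : ℝ) * (Γ.1.autCard : ℝ)))
    (fun _ _ h => h.elim fun s => by simp only [OrdGraph.autCard_eq_of_iso s])

open scoped Classical in
/-- The weighted number of connected ordinary graphs of genus `g` with `n` vertices of valencies
`d 0, …, d (n - 1)`: the sum of the weights over all isomorphism classes. -/
noncomputable def og {n : ℕ} (g : ℕ) (d : Fin n → ℕ) : ℝ :=
  ∑ c : Quotient (isoSetoid g d), weight g d c

/-- The normalized count `d₁! ⋯ dₙ! n! og_g(d₁, …, dₙ) / (2g + 2n - 3)!!`. -/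
noncomputable def ogNormalized {n : ℕ} (g : ℕ) (d : Fin n → ℕ) : ℝ :=
  ((∏ k, ((d k).factorial : ℝ)) * (n.factorial : ℝ)) /
    (Nat.doubleFactorial (2 * g + 2 * n - 3) : ℝ) * og g d

/-- The Hermitian matrix with the `N ^ 2` real coordinates `x`: the diagonal entries are `x a a`,
and for `a < b` the `(a, b)` entry has real part `x a b` and imaginary part `x b a`. -/
noncomputable def hermitianOf {N : ℕ} (x : Fin N → Fin N → ℝ) : Matrix (Fin N) (Fin N) ℂ :=
  Matrix.of fun a b =>
    if a = b then (x a a : ℂ)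
    else if a < b then (x a b : ℂ) + (x b a : ℂ) * Complex.I
    else (x b a : ℂ) - (x a b : ℂ) * Complex.I

theorem hermitianOf_isHermitian {N : ℕ} (x : Fin N → Fin N → ℝ) :
    (hermitianOf x).IsHermitian := by
  ext a b
  rcases lt_trichotomy a b with h | h | h
  · simp [hermitianOf, h, h.ne, h.ne', not_lt_of_gt h, sub_eq_add_neg]
  · subst h
    simp [hermitianOf]
  · simp [hermitianOf, h, h.ne, h.ne', not_lt_of_gt h, sub_eq_add_neg]

/-- `tr M ^ k` for the Hermitian matrix `M` with coordinates `x` (a real number). -/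
noncomputable def trPow {N : ℕ} (k : ℕ) (x : Fin N → Fin N → ℝ) : ℝ :=
  ((hermitianOf x ^ k).trace).re

/-- The expectation of a function of an `N × N` Hermitian matrix `M` with respect to the
GUE density, proportional to `exp (- tr M ^ 2 / 2)`. -/
noncomputable def gueExpect (N : ℕ) (f : (Fin N → Fin N → ℝ) → ℝ) : ℝ :=
  (∫ x : Fin N → Fin N → ℝ, f x * Real.exp (-(1 / 2) * trPow 2 x)) /
    ∫ x : Fin N → Fin N → ℝ, Real.exp (-(1 / 2) * trPow 2 x)

/-- The connected GUE correlator `⟨tr M ^ d₁ ⋯ tr M ^ dₙ⟩_c (N)`: the joint cumulant of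
`tr M ^ d₁, …, tr M ^ dₙ`, a sum over the set partitions of the index set. -/
noncomputable def gueCorrelator {n : ℕ} (N : ℕ) (d : Fin n → ℕ) : ℝ :=
  ∑ π : Finpartition (Finset.univ : Finset (Fin n)),
    (-1 : ℝ) ^ (π.parts.card - 1) * ((π.parts.card - 1).factorial : ℝ) *
      ∏ B ∈ π.parts, gueExpect N fun x => ∏ k ∈ B, trPow (d k) x

end OrdinaryGraphs

/-! Graphs on fixed half-edges are perfect matchings, and relabelling the half-edges at each vertex
is a group action of order `∏ d_k!`. By orbit-stabilizer, `∏ d_k! · n! · og_g(d)` is therefore the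
plain number of connected matchings (`og_eq_card_connGraph`).

For the correlator, at `N = 1` traces of powers are powers of one standard Gaussian, whose `D`-th
moment counts the matchings of `D` points. Each product over blocks in the cumulant thus counts
graphs whose edges stay within blocks (`card_compatible_partition`). Exchanging the sums leaves, for
each graph, a Möbius sum over the partitions coarser than its components, which is 1 if the graph is
connected and 0 otherwise (`sum_partition_connected`).

For the limit, `(2g+2n-3)!!` counts all matchings, so the normalized count is the proportion of
connected ones. A disconnected graph has a union of components avoiding the last vertex. For each of
the finitely many possible vertex sets of such a union, the proportion of graphs is `O(1/g)`
(`matchingCount_mul_le`). -/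

namespace OrdinaryGraphs

/-! ### Counting perfect matchings. -/

/-- Fixed-point-free involutions of a type. -/
abbrev FixedPointFreeInvolution (X : Type*) : Type _ :=
  {f : Equiv.Perm X // (∀ x, f (f x) = x) ∧ ∀ x, f x ≠ x}

/-- The number of perfect matchings of a set with `D` elements. -/
def matchingCount (D : ℕ) : ℕ := if Even D then (D - 1).doubleFactorial else 0

theorem factorial_two_mul (k : ℕ) :
    (2 * k).factorial = 2 ^ k * k.factorial * (2 * k - 1).doubleFactorial := by
  rcases k with _ | k
  · simp
  · have h := Nat.factorial_eq_mul_doubleFactorial (2 * k + 1)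
    have h2 := Nat.doubleFactorial_two_mul (k + 1)
    rw [show 2 * (k + 1) - 1 = 2 * k + 1 by omega, ← h2]
    exact h

theorem cycleType_eq_replicate_two_iff {X : Type*} [Fintype X] [DecidableEq X] {k : ℕ}
    (hk : Fintype.card X = 2 * k) (f : Equiv.Perm X) :
    f.cycleType = Multiset.replicate k 2 ↔ (∀ x, f (f x) = x) ∧ ∀ x, f x ≠ x := by
  have h1 : (∀ x, f (f x) = x) ↔ ∀ c ∈ f.cycleType, c = 2 := by
    rw [← Equiv.Perm.pow_prime_eq_one_iff, Equiv.ext_iff]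
    simp [pow_two]
  have h2 : (∀ x, f x ≠ x) ↔ f.cycleType.sum = 2 * k := by
    rw [Equiv.Perm.sum_cycleType, ← hk, Finset.card_eq_iff_eq_univ, Finset.eq_univ_iff_forall]
    simp
  rw [h1, h2, Multiset.eq_replicate]
  constructor
  · rintro ⟨hc, h⟩
    refine ⟨h, ?_⟩
    rw [Multiset.eq_replicate_of_mem h, hc]
    simp [mul_comm]
  · rintro ⟨h, hs⟩
    refine ⟨?_, h⟩
    rw [Multiset.eq_replicate_of_mem h] at hs
    simp only [Multiset.sum_replicate, smul_eq_mul] at hs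
    omega

/-- For `2k` points these are the permutations of cycle type `2^k`, so there are `(2k)! / (2^k k!) =
(2k-1)!!` of them. An odd set has none, since the 2-cycles would exhaust it. -/
theorem card_fixedPointFreeInvolution (X : Type*) [Finite X] :
    Nat.card (FixedPointFreeInvolution X) = matchingCount (Nat.card X) := by
  classical
  have := Fintype.ofFinite X
  rw [Nat.card_eq_fintype_card (α := X)]
  by_cases hX : Even (Fintype.card X)
  · obtain ⟨k, hk⟩ := even_iff_two_dvd.1 hX
    rw [matchingCount, if_pos hX, hk, Nat.card_eq_fintype_card, Fintype.card_subtype]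
    have h := Equiv.Perm.card_of_cycleType_mul_eq X (Multiset.replicate k 2)
    simp_rw [cycleType_eq_replicate_two_iff hk] at h
    have hcount : ∏ n ∈ (Multiset.replicate k 2).toFinset,
        ((Multiset.replicate k 2).count n).factorial = k.factorial := by
      rcases k with _ | k
      · simp
      · rw [Multiset.toFinset_replicate, if_neg (by omega)]
        simp
    rw [if_pos ⟨by simp [hk, mul_comm], fun a ha => (Multiset.eq_of_mem_replicate ha).ge⟩, hcount,
      hk, factorial_two_mul] at h
    simp only [Multiset.sum_replicate, Multiset.prod_replicate, smul_eq_mul] at h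
    rw [show 2 * k - k * 2 = 0 by omega, Nat.factorial_zero, one_mul, mul_comm] at h
    exact Nat.eq_of_mul_eq_mul_left (by positivity) h
  · rw [matchingCount, if_neg hX]
    have : IsEmpty (FixedPointFreeInvolution X) := by
      refine ⟨fun f => hX ?_⟩
      have h1 : ∀ c ∈ f.1.cycleType, c = 2 := by
        rw [← Equiv.Perm.pow_prime_eq_one_iff, Equiv.ext_iff]
        simpa [pow_two] using f.2.1
      have h2 : f.1.support = Finset.univ := by
        rw [Finset.eq_univ_iff_forall]
        simpa using f.2.2
      have h3 := f.1.sum_cycleType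
      rw [h2, Finset.card_univ, Multiset.eq_replicate_of_mem h1] at h3
      rw [← h3]
      simp
    simp

theorem involutive_glue {X ι : Type*} {p : X → ι}
    (F : ∀ i, FixedPointFreeInvolution {x // p x = i}) :
    Function.Involutive fun x => ((F (p x)).1 ⟨x, rfl⟩ : X) := by
  intro x
  -- The involution is indexed by the fibre of its argument; a free index `i` lets the two
  -- applications use the same fibre.
  have key : ∀ i (y : {x // p x = i}),
      (((F (p y.1)).1 ⟨y.1, rfl⟩ : {x // p x = p y.1}) : X) = (F i).1 y := by
    rintro i ⟨y, rfl⟩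
    rfl
  exact (key (p x) _).trans (congrArg Subtype.val ((F (p x)).2.1 ⟨x, rfl⟩))

/-- A fixed-point-free involution that preserves the fibres of a map is a family of
fixed-point-free involutions of the fibres. -/
def fiberwiseEquiv {X ι : Type*} (p : X → ι) :
    {f : FixedPointFreeInvolution X // ∀ x, p (f.1 x) = p x} ≃
      ∀ i, FixedPointFreeInvolution {x // p x = i} where
  toFun f i :=
    ⟨f.1.1.subtypeEquiv fun x => by rw [f.2 x],
      fun x => Subtype.ext (f.1.2.1 x), fun x h => f.1.2.2 x (congrArg Subtype.val h)⟩
  invFun F :=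
    ⟨⟨(involutive_glue F).toPerm, involutive_glue F,
      fun x h => (F (p x)).2.2 ⟨x, rfl⟩ (Subtype.ext h)⟩, fun x => ((F (p x)).1 ⟨x, rfl⟩).2⟩
  left_inv f := by
    apply Subtype.ext
    apply Subtype.ext
    ext x
    rfl
  right_inv F := by
    funext i
    apply Subtype.ext
    ext ⟨x, rfl⟩
    rfl

theorem card_fiberwise {X ι : Type*} [Finite X] [Fintype ι] (p : X → ι) :
    Nat.card {f : FixedPointFreeInvolution X // ∀ x, p (f.1 x) = p x} =
      ∏ i, matchingCount (Nat.card {x // p x = i}) := by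
  rw [Nat.card_congr (fiberwiseEquiv p), Nat.card_pi]
  exact Finset.prod_congr rfl fun i _ => card_fixedPointFreeInvolution _

/-! ### Möbius inversion on set partitions through falling factorials. -/

open Polynomial in
theorem coeff_one_descPochhammer (k : ℕ) :
    (descPochhammer ℝ (k + 1)).coeff 1 = (-1) ^ k * (k.factorial : ℝ) := by
  have h : ∀ k : ℕ, (descPochhammer ℝ k).eval (-1) = (-1) ^ k * (k.factorial : ℝ) := by
    intro k
    induction k with
    | zero => simp
    | succ k ih =>
      rw [descPochhammer_succ_right, eval_mul, ih, Nat.factorial_succ]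
      simp
      ring
  rw [descPochhammer_succ_left, coeff_X_mul, coeff_zero_eq_eval_zero, eval_comp]
  simpa using h k

/-- Colourings that are constant on the edges are functions of the connected components. -/
theorem card_constant_on_adj {V : Type*} [Finite V] (G : SimpleGraph V) (N : ℕ) :
    Nat.card {f : V → Fin N // ∀ a b, G.Adj a b → f a = f b} =
      N ^ Nat.card G.ConnectedComponent := by
  have : Finite G.ConnectedComponent := Quot.finite _
  have h : Nat.card (G.ConnectedComponent → Fin N) = N ^ Nat.card G.ConnectedComponent := by
    rw [Nat.card_fun]; simp
  rw [← h]
  symm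
  refine Nat.card_eq_of_bijective
    (fun F : G.ConnectedComponent → Fin N =>
      (⟨fun v => F (G.connectedComponentMk v), fun a b hab => by
        exact congrArg F (SimpleGraph.ConnectedComponent.sound hab.reachable)⟩ :
        {f : V → Fin N // ∀ a b, G.Adj a b → f a = f b})) ⟨?_, ?_⟩
  · intro F F' h
    funext c
    induction c using SimpleGraph.ConnectedComponent.ind with
    | h v => exact congrFun (congrArg Subtype.val h) v
  · rintro ⟨f, hf⟩
    refine ⟨fun c => c.lift f fun v w p _ => ?_, ?_⟩
    · induction p with
      | nil => rfl
      | cons hab q ih => exact (hf _ _ hab).trans (ih (SimpleGraph.Walk.IsPath.of_cons ‹_›))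
    · rfl

section Partition

variable {V : Type*} [Fintype V] [DecidableEq V]

theorem finpartition_ext_part {π ρ : Finpartition (Finset.univ : Finset V)}
    (h : ∀ a b, π.part a = π.part b ↔ ρ.part a = ρ.part b) : π = ρ := by
  have hpart : ∀ a, π.part a = ρ.part a := by
    intro a
    ext b
    rw [π.mem_part_iff_part_eq_part (Finset.mem_univ b) (Finset.mem_univ a),
      ρ.mem_part_iff_part_eq_part (Finset.mem_univ b) (Finset.mem_univ a), h]
  ext B
  constructor
  · intro hB
    obtain ⟨a, -, rfl⟩ := π.part_surjOn hB
    rw [hpart]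
    exact ρ.part_mem.2 (Finset.mem_univ a)
  · intro hB
    obtain ⟨a, -, rfl⟩ := ρ.part_surjOn hB
    rw [← hpart]
    exact π.part_mem.2 (Finset.mem_univ a)

/-- The partition of a finite set into the fibres of a map. -/
noncomputable def kerPartition {Y : Type*} (f : V → Y) :
    Finpartition (Finset.univ : Finset V) :=
  have : DecidableRel (Setoid.ker f).r := Classical.decRel _
  Finpartition.ofSetoid (Setoid.ker f)

theorem kerPartition_part_eq_iff {Y : Type*} (f : V → Y) (a b : V) :
    (kerPartition f).part a = (kerPartition f).part b ↔ f a = f b := by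
  have : DecidableRel (Setoid.ker f).r := Classical.decRel _
  rw [← Finpartition.mem_part_iff_part_eq_part _ (Finset.mem_univ a) (Finset.mem_univ b),
    eq_comm (a := f a), ← Setoid.ker_def (f := f), kerPartition]
  convert! Finpartition.mem_part_ofSetoid_iff_rel (s := Setoid.ker f) (a := b) (b := a)

theorem kerPartition_eq_iff {Y : Type*} (f : V → Y) (π : Finpartition (Finset.univ : Finset V)) :
    kerPartition f = π ↔ ∀ a b, f a = f b ↔ π.part a = π.part b := by
  constructor
  · rintro rfl a b
    exact (kerPartition_part_eq_iff f a b).symm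
  · intro h
    exact finpartition_ext_part fun a b => (kerPartition_part_eq_iff f a b).trans (h a b)

/-- A colouring with fibres exactly the blocks of `π` is an injection of the blocks into the
colours. -/
theorem card_kerPartition_eq (N : ℕ) (π : Finpartition (Finset.univ : Finset V)) :
    Nat.card {f : V → Fin N // kerPartition f = π} = N.descFactorial π.parts.card := by
  have hcard : Nat.card (π.parts ↪ Fin N) = N.descFactorial π.parts.card := by
    rw [Nat.card_eq_fintype_card, Fintype.card_embedding_eq]
    simp
  have hp : ∀ v, π.part v ∈ π.parts := fun v => π.part_mem.2 (Finset.mem_univ v)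
  rw [← hcard]
  symm
  refine Nat.card_eq_of_bijective
    (fun e : π.parts ↪ Fin N =>
      (⟨fun v => e ⟨π.part v, hp v⟩, (kerPartition_eq_iff _ _).2 fun a b => by simp⟩ :
        {f : V → Fin N // kerPartition f = π})) ⟨?_, ?_⟩
  · intro e e' h
    ext ⟨B, hB⟩
    obtain ⟨a, -, rfl⟩ := π.part_surjOn hB
    exact congrArg Fin.val (congrFun (congrArg Subtype.val h) a)
  · rintro ⟨f, hf⟩
    rw [kerPartition_eq_iff] at hf
    choose r hr hr' using fun B : π.parts => π.part_surjOn B.2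
    refine ⟨⟨fun B => f (r B), fun B B' h => ?_⟩, ?_⟩
    · have := (hf _ _).1 h
      rw [hr', hr'] at this
      exact Subtype.ext this
    · apply Subtype.ext
      funext v
      exact (hf _ _).2 (hr' _)

-- At each natural `N` both sides count the `N`-colourings constant on components, the left side
-- sorting them by their partition into fibres. Agreement at infinitely many points gives the
-- polynomial identity.
open scoped Classical in
open Polynomial in
theorem sum_descPochhammer (G : SimpleGraph V) :
    ∑ π : Finpartition (Finset.univ : Finset V),
      (if ∀ a b, G.Adj a b → π.part a = π.part b then descPochhammer ℝ π.parts.card else 0) =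
      X ^ Nat.card G.ConnectedComponent := by
  apply Polynomial.eq_of_infinite_eval_eq
  refine Set.infinite_of_injective_forall_mem (f := fun N : ℕ => (N : ℝ)) Nat.cast_injective ?_
  intro N
  simp only [Set.mem_ofPred_eq, eval_finsetSum, eval_pow, eval_X]
  rw [← Nat.cast_pow, ← card_constant_on_adj, Nat.card_eq_fintype_card, Fintype.card_subtype,
    Finset.card_eq_sum_card_fiberwise (f := kerPartition) (t := Finset.univ) (by simp),
    Nat.cast_sum]
  refine Finset.sum_congr rfl fun π _ => ?_
  rw [Finset.filter_filter]
  split_ifs with h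
  · rw [descPochhammer_eval_eq_descFactorial, ← card_kerPartition_eq, Nat.card_eq_fintype_card,
      Fintype.card_subtype]
    congr 2
    ext f
    simp only [Finset.mem_filter, Finset.mem_univ, true_and]
    refine ⟨fun hf => ⟨fun a b hab => ?_, hf⟩, fun hf => hf.2⟩
    exact ((kerPartition_eq_iff f π).1 hf a b).2 (h a b hab)
  · rw [eval_zero, eq_comm, Nat.cast_eq_zero, Finset.card_eq_zero, Finset.filter_eq_empty_iff]
    rintro f - ⟨hf, hπ⟩
    exact h fun a b hab => ((kerPartition_eq_iff f π).1 hπ a b).1 (hf a b hab)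

open scoped Classical in
/-- Möbius inversion in the partition lattice, above the partition into connected components. -/
theorem sum_partition_connected [Nonempty V] (G : SimpleGraph V) :
    ∑ π : Finpartition (Finset.univ : Finset V),
      (if ∀ a b, G.Adj a b → π.part a = π.part b then
        (-1 : ℝ) ^ (π.parts.card - 1) * ((π.parts.card - 1).factorial : ℝ) else 0) =
      if G.Connected then 1 else 0 := by
  -- The linear coefficient of a falling factorial is the Möbius weight, and that of `X ^ c` is 1
  -- exactly when `c = 1`.
  have h := congrArg (fun p => p.coeff 1) (sum_descPochhammer G)
  simp only [Polynomial.finsetSum_coeff, Polynomial.coeff_X_pow] at h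
  have hc : G.Connected ↔ 1 = Nat.card G.ConnectedComponent := by
    rw [eq_comm, Nat.card_eq_one_iff_unique, SimpleGraph.connected_iff]
    have : Nonempty G.ConnectedComponent := ⟨G.connectedComponentMk (Classical.arbitrary V)⟩
    simp only [this, and_true, ‹Nonempty V›]
    exact ⟨fun h => h.subsingleton_connectedComponent,
      fun h a b => SimpleGraph.ConnectedComponent.exact (Subsingleton.elim _ _)⟩
  simp only [hc]
  rw [← h]
  refine Finset.sum_congr rfl fun π _ => ?_
  have hpos : 0 < π.parts.card :=
    Finset.card_pos.2 (π.parts_nonempty Finset.univ_nonempty.ne_empty)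
  obtain ⟨k, hk⟩ := Nat.exists_eq_add_of_lt hpos
  rw [zero_add] at hk
  split_ifs
  · rw [hk, coeff_one_descPochhammer, Nat.add_sub_cancel]
  · simp

end Partition

/-! ### Gaussian moments and the one-by-one GUE. -/

theorem trPow_one (k : ℕ) (x : Fin 1 → Fin 1 → ℝ) : trPow k x = x 0 0 ^ k := by
  have h : hermitianOf x = Matrix.diagonal fun _ => (x 0 0 : ℂ) := by
    ext a b
    fin_cases a; fin_cases b
    simp [hermitianOf]
  rw [trPow, h, Matrix.diagonal_pow, Matrix.trace_diagonal]
  simp [← Complex.ofReal_pow]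

theorem integral_fin_one (f : ℝ → ℝ) :
    ∫ x : Fin 1 → Fin 1 → ℝ, f (x 0 0) = ∫ t, f t := by
  have h1 := (MeasureTheory.volume_preserving_funUnique (Fin 1) ℝ).integral_comp
    (MeasurableEquiv.measurableEmbedding _) f
  have h2 := (MeasureTheory.volume_preserving_funUnique (Fin 1) (Fin 1 → ℝ)).integral_comp
    (MeasurableEquiv.measurableEmbedding _) (fun y => f (y 0))
  exact h2.trans h1

theorem integral_even_pow_mul_gaussian (k : ℕ) :
    ∫ t : ℝ, t ^ (2 * k) * Real.exp (-(1 / 2) * t ^ 2) =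
      ((2 * k - 1).doubleFactorial : ℝ) * (√2 * √Real.pi) := by
  have h := integral_comp_abs (f := fun t : ℝ => t ^ (2 * k) * Real.exp (-(1 / 2) * t ^ 2))
  simp only [sq_abs, (even_two_mul k).pow_abs] at h
  rw [h]
  have h2 := integral_rpow_mul_exp_neg_mul_rpow (p := 2) (q := ((2 * k : ℕ) : ℝ)) (b := 1 / 2)
    (by norm_num) (by have : (0 : ℝ) ≤ ((2 * k : ℕ) : ℝ) := Nat.cast_nonneg _
                      linarith) (by norm_num)
  simp only [Real.rpow_natCast, Real.rpow_two] at h2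
  rw [h2, show (((2 * k : ℕ) : ℝ) + 1) / 2 = k + 1 / 2 by push_cast; ring,
    Real.Gamma_nat_add_half, show -(((2 * k : ℕ) : ℝ) + 1) / 2 = -((k : ℝ) + 1 / 2) by
      push_cast; ring, Real.rpow_neg (by norm_num), ← Real.inv_rpow (by norm_num),
    show ((1 / 2 : ℝ))⁻¹ = 2 by norm_num, Real.rpow_add (by norm_num), Real.rpow_natCast,
    ← Real.sqrt_eq_rpow]
  field_simp

theorem integral_odd_pow_mul_gaussian {D : ℕ} (hD : Odd D) :
    ∫ t : ℝ, t ^ D * Real.exp (-(1 / 2) * t ^ 2) = 0 := by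
  have h := MeasureTheory.integral_neg_eq_self
    (fun t : ℝ => t ^ D * Real.exp (-(1 / 2) * t ^ 2)) MeasureTheory.volume
  simp only [hD.neg_pow, neg_sq, neg_mul (_ ^ D), MeasureTheory.integral_neg] at h
  linarith

theorem gaussian_moment (D : ℕ) :
    (∫ t : ℝ, t ^ D * Real.exp (-(1 / 2) * t ^ 2)) / ∫ t : ℝ, Real.exp (-(1 / 2) * t ^ 2) =
      matchingCount D := by
  have h0 := integral_even_pow_mul_gaussian 0
  simp only [mul_zero, pow_zero, one_mul, Nat.zero_sub, Nat.doubleFactorial, Nat.cast_one] at h0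
  rw [h0, matchingCount]
  split_ifs with hD
  · obtain ⟨k, rfl⟩ := even_iff_two_dvd.1 hD
    rw [integral_even_pow_mul_gaussian]
    exact mul_div_cancel_right₀ _ (by positivity)
  · rw [integral_odd_pow_mul_gaussian (Nat.not_even_iff_odd.1 hD)]
    simp

theorem gueExpect_one_prod_trPow {ι : Type*} (B : Finset ι) (d : ι → ℕ) :
    gueExpect 1 (fun x => ∏ k ∈ B, trPow (d k) x) = matchingCount (∑ k ∈ B, d k) := by
  simp only [gueExpect, trPow_one, Finset.prod_pow_eq_pow_sum]
  rw [integral_fin_one (fun t => t ^ (∑ k ∈ B, d k) * Real.exp (-(1 / 2) * t ^ 2)),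
    integral_fin_one (fun t => Real.exp (-(1 / 2) * t ^ 2)), gaussian_moment]

/-! ### Graphs as involutions of half-edges. -/

namespace OrdGraph

variable {n : ℕ} {d : Fin n → ℕ}

/-- A graph is a fixed-point-free involution of its half-edges. -/
def equivInvolution (d : Fin n → ℕ) : OrdGraph d ≃ FixedPointFreeInvolution (HalfEdge d) where
  toFun Γ := ⟨Γ.flip, Γ.flip_flip, Γ.flip_ne⟩
  invFun f := ⟨f.1, f.2.1, f.2.2⟩
  left_inv _ := rfl
  right_inv _ := rfl

theorem card_eq_matchingCount (d : Fin n → ℕ) :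
    Nat.card (OrdGraph d) = matchingCount (∑ k, d k) := by
  rw [Nat.card_congr (equivInvolution d), card_fixedPointFreeInvolution]
  simp

theorem card_connected_le (d : Fin n → ℕ) :
    Nat.card {Γ : OrdGraph d // Γ.Connected} ≤ matchingCount (∑ k, d k) := by
  rw [← card_eq_matchingCount]
  exact Finite.card_subtype_le _

theorem card_halfEdge_over {ι : Type*} [DecidableEq ι] (d : Fin n → ℕ) (p : Fin n → ι) (i : ι) :
    Nat.card {h : HalfEdge d // p h.1 = i} = ∑ k with p k = i, d k := by
  rw [Nat.card_eq_fintype_card, Fintype.card_subtype, Finset.card_filter, Fintype.sum_sigma,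
    Finset.sum_filter]
  refine Finset.sum_congr rfl fun k _ => ?_
  split_ifs <;> simp

/-- The number of graphs whose edges join vertices in the same fibre of a map. -/
theorem card_fiberwise {ι : Type*} [Fintype ι] [DecidableEq ι] (d : Fin n → ℕ)
    (p : Fin n → ι) :
    Nat.card {Γ : OrdGraph d // ∀ h, p (Γ.flip h).1 = p h.1} =
      ∏ i, matchingCount (∑ k with p k = i, d k) := by
  have e : {Γ : OrdGraph d // ∀ h, p (Γ.flip h).1 = p h.1} ≃
      {f : FixedPointFreeInvolution (HalfEdge d) // ∀ h, p (f.1 h).1 = p h.1} :=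
    (equivInvolution d).subtypeEquiv fun _ => Iff.rfl
  rw [Nat.card_congr e, OrdinaryGraphs.card_fiberwise fun h : HalfEdge d => p h.1]
  exact Finset.prod_congr rfl fun i _ => by rw [card_halfEdge_over]

/-- Sending a half-edge to its edge is two-to-one, because `flip` has no fixed points. Hence the
valencies alone determine the genus. -/
theorem two_mul_card_edges (Γ : OrdGraph d) : 2 * Γ.edges.card = ∑ k, d k := by
  have hcard : Fintype.card (HalfEdge d) = ∑ k, d k := by simp
  rw [← hcard, ← Finset.card_univ, Finset.card_eq_sum_card_image fun h => s(h, Γ.flip h)]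
  rw [Finset.sum_const_nat (m := 2), mul_comm]
  · rfl
  · intro e he
    obtain ⟨h, -, rfl⟩ := Finset.mem_image.1 he
    rw [← Finset.card_pair (Γ.flip_ne h).symm]
    congr 1
    ext x
    simp only [Finset.mem_filter, Finset.mem_univ, true_and, Finset.mem_insert,
      Finset.mem_singleton, Sym2.eq_iff]
    constructor
    · rintro (h | h)
      · exact Or.inl h.1
      · exact Or.inr h.1
    · rintro (rfl | rfl)
      · simp
      · simp [Γ.flip_flip]

theorem genus_eq (Γ : OrdGraph d) {g : ℕ} (h : ∑ k, d k = 2 * g + 2 * n - 2) (hn : 1 ≤ n) :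
    Γ.genus = g := by
  have := Γ.two_mul_card_edges
  unfold genus
  omega

theorem genus_eq_genus (Γ Γ' : OrdGraph d) : Γ.genus = Γ'.genus := by
  have := Γ.two_mul_card_edges
  have := Γ'.two_mul_card_edges
  unfold genus
  omega

theorem constant_on_adj_iff {ι : Type*} (Γ : OrdGraph d) (p : Fin n → ι) :
    (∀ a b, Γ.toSimpleGraph.Adj a b → p a = p b) ↔ ∀ h, p (Γ.flip h).1 = p h.1 := by
  simp only [toSimpleGraph, SimpleGraph.fromRel_adj]
  constructor
  · intro H h
    by_cases hh : (Γ.flip h).1 = h.1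
    · rw [hh]
    · exact H _ _ ⟨hh, Or.inr ⟨h, rfl, rfl⟩⟩
  · rintro H a b ⟨-, ⟨h, rfl, rfl⟩ | ⟨h, rfl, rfl⟩⟩
    · exact (H h).symm
    · exact H h

/-- The graph obtained by permuting the half-edges at each vertex. -/
def conj (s : (k : Fin n) → Equiv.Perm (Fin (d k))) (Γ : OrdGraph d) : OrdGraph d where
  flip := (Equiv.sigmaCongrRight s).symm.trans (Γ.flip.trans (Equiv.sigmaCongrRight s))
  flip_flip h := by
    simp only [Equiv.trans_apply, Equiv.symm_apply_apply, Γ.flip_flip, Equiv.apply_symm_apply]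
  flip_ne h H := by
    simp only [Equiv.trans_apply] at H
    rw [← Equiv.eq_symm_apply] at H
    exact Γ.flip_ne _ H

def isoConj (s : (k : Fin n) → Equiv.Perm (Fin (d k))) (Γ : OrdGraph d) : Iso Γ (conj s Γ) :=
  ⟨s, fun h => by simp only [conj, Equiv.trans_apply, Equiv.symm_apply_apply]⟩

theorem Iso.adj {Γ Γ' : OrdGraph d} (s : Iso Γ Γ') {a b : Fin n}
    (h : Γ.toSimpleGraph.Adj a b) : Γ'.toSimpleGraph.Adj a b := by
  have key : ∀ a b, (∃ h : HalfEdge d, h.1 = a ∧ (Γ.flip h).1 = b) →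
      ∃ h : HalfEdge d, h.1 = a ∧ (Γ'.flip h).1 = b := by
    rintro a b ⟨h, rfl, rfl⟩
    exact ⟨Equiv.sigmaCongrRight s.1 h, rfl, by rw [← s.2 h]; rfl⟩
  rw [toSimpleGraph, SimpleGraph.fromRel_adj] at h ⊢
  exact ⟨h.1, h.2.imp (key _ _) (key _ _)⟩

theorem Iso.connected {Γ Γ' : OrdGraph d} (s : Iso Γ Γ') (h : Γ.Connected) : Γ'.Connected :=
  SimpleGraph.Connected.mono (fun _ _ => s.adj) h

theorem Iso.eq_of_val_eq {Γ Γ' Γ'' : OrdGraph d} (s : Iso Γ Γ') (t : Iso Γ Γ'')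
    (h : s.1 = t.1) : Γ' = Γ'' := by
  apply OrdGraph.ext
  ext x : 1
  obtain ⟨y, rfl⟩ := (Equiv.sigmaCongrRight s.1).surjective x
  rw [← s.2, h, t.2]

instance {Γ Γ' : OrdGraph d} : Finite (Iso Γ Γ') := Subtype.finite

theorem Iso.card_eq {Γ Γ' : OrdGraph d} (s : Iso Γ Γ') : Nat.card (Iso Γ Γ') = Γ.autCard := by
  refine Nat.card_congr ⟨fun t => t.trans s.symm, fun t => t.trans s, ?_, ?_⟩ <;>
  · intro t
    apply Subtype.ext
    funext k
    ext x
    simp [Iso.trans, Iso.symm]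

theorem autCard_pos (Γ : OrdGraph d) : 0 < Γ.autCard :=
  have : Nonempty (Iso Γ Γ) := ⟨Iso.refl Γ⟩
  Nat.card_pos

end OrdGraph

/-! ### From isomorphism classes to labelled connected graphs. -/

open scoped Classical in
/-- Orbit-stabilizer: an isomorphism class has `∏ d_k! / #Aut` elements. -/
theorem card_class_mul_autCard {n g : ℕ} {d : Fin n → ℕ} (Γ : ConnGraph g d) :
    (Finset.univ.filter fun Γ' : ConnGraph g d =>
      (Quotient.mk (isoSetoid g d) Γ' = Quotient.mk (isoSetoid g d) Γ)).card * Γ.1.autCard =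
      ∏ k, (d k).factorial := by
  -- A tuple of vertexwise permutations determines its target graph, so isomorphisms out of `Γ`
  -- correspond to such tuples.
  have hcard : Nat.card (Σ Γ' : ConnGraph g d, OrdGraph.Iso Γ.1 Γ'.1) =
      ∏ k, (d k).factorial := by
    have : ∏ k, (d k).factorial = Nat.card ((k : Fin n) → Equiv.Perm (Fin (d k))) := by
      rw [Nat.card_pi]
      simp [Fintype.card_perm]
    rw [this]
    refine Nat.card_eq_of_bijective (fun x => x.2.1) ⟨?_, fun s => ?_⟩
    · rintro ⟨Γ', s⟩ ⟨Γ'', t⟩ h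
      obtain rfl : Γ' = Γ'' := Subtype.ext (s.eq_of_val_eq t h)
      obtain rfl : s = t := Subtype.ext h
      rfl
    · exact ⟨⟨⟨Γ.1.conj s, (Γ.1.isoConj s).connected Γ.2.1,
        (OrdGraph.genus_eq_genus _ _).trans Γ.2.2⟩, Γ.1.isoConj s⟩, rfl⟩
  rw [← hcard, Nat.card_sigma, Finset.card_filter, Finset.sum_mul]
  refine Finset.sum_congr rfl fun Γ' _ => ?_
  split_ifs with h
  · obtain ⟨s⟩ := Quotient.exact h.symm
    rw [OrdGraph.Iso.card_eq s, one_mul]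
  · have : IsEmpty (OrdGraph.Iso Γ.1 Γ'.1) := ⟨fun s => h (Quotient.sound (s := isoSetoid g d) (Nonempty.intro s)).symm⟩
    simp

theorem og_eq_card_connGraph {n : ℕ} (g : ℕ) (d : Fin n → ℕ) :
    og g d = (Nat.card (ConnGraph g d) : ℝ) /
      ((∏ k, ((d k).factorial : ℝ)) * (n.factorial : ℝ)) := by
  classical
  rw [og, Nat.card_eq_fintype_card, ← Finset.card_univ,
    Finset.card_eq_sum_card_fiberwise (f := Quotient.mk (isoSetoid g d)) (t := Finset.univ)
      (by simp), Nat.cast_sum, Finset.sum_div]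
  refine Finset.sum_congr rfl fun c _ => ?_
  induction c using Quotient.inductionOn with
  | h Γ =>
    have h := card_class_mul_autCard Γ
    have hpos : (0 : ℝ) < Γ.1.autCard := Nat.cast_pos.2 Γ.1.autCard_pos
    have hprod : (0 : ℝ) < ∏ k, ((d k).factorial : ℝ) :=
      Finset.prod_pos fun k _ => Nat.cast_pos.2 (d k).factorial_pos
    have hn : (0 : ℝ) < n.factorial := Nat.cast_pos.2 n.factorial_pos
    have h' := congrArg (Nat.cast (R := ℝ)) h
    push_cast at h'
    change 1 / ((n.factorial : ℝ) * (Γ.1.autCard : ℝ)) = _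
    rw [div_eq_div_iff (by positivity) (by positivity), ← h']
    ring

theorem card_connGraph {n g : ℕ} {d : Fin n → ℕ} (hn : 1 ≤ n)
    (hd : ∑ k, d k = 2 * g + 2 * n - 2) :
    Nat.card (ConnGraph g d) = Nat.card {Γ : OrdGraph d // Γ.Connected} :=
  Nat.card_congr (Equiv.subtypeEquivRight fun Γ => by simp [Γ.genus_eq hd hn])

/-! ### Connected graphs and the cumulant. -/

/-- The number of graphs whose edges join vertices in the same block of a partition. -/
theorem card_compatible_partition {n : ℕ} (d : Fin n → ℕ)
    (π : Finpartition (Finset.univ : Finset (Fin n))) :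
    Nat.card {Γ : OrdGraph d // ∀ h, π.part (Γ.flip h).1 = π.part h.1} =
      ∏ B ∈ π.parts, matchingCount (∑ k ∈ B, d k) := by
  have hp : ∀ v, π.part v ∈ π.parts := fun v => π.part_mem.2 (Finset.mem_univ v)
  have h := OrdGraph.card_fiberwise d fun k => (⟨π.part k, hp k⟩ : π.parts)
  simp only [Subtype.mk.injEq] at h
  rw [h, ← Finset.prod_coe_sort π.parts fun B => matchingCount (∑ k ∈ B, d k)]
  refine Finset.prod_congr rfl fun B _ => ?_
  congr 1
  refine Finset.sum_congr ?_ fun _ _ => rfl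
  ext k
  simp [Subtype.ext_iff, π.part_eq_iff_mem B.2]

theorem card_connected_eq_gueCorrelator {n : ℕ} (hn : 1 ≤ n) (d : Fin n → ℕ) :
    (Nat.card {Γ : OrdGraph d // Γ.Connected} : ℝ) = gueCorrelator 1 d := by
  classical
  have : Nonempty (Fin n) := ⟨⟨0, hn⟩⟩
  simp only [gueCorrelator, gueExpect_one_prod_trPow, ← Nat.cast_prod,
    ← card_compatible_partition, Nat.card_eq_fintype_card, Fintype.card_subtype,
    Finset.card_filter, Nat.cast_sum, Finset.mul_sum]
  rw [Finset.sum_comm]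
  refine Finset.sum_congr rfl fun Γ _ => ?_
  have h := sum_partition_connected Γ.toSimpleGraph
  rw [OrdGraph.Connected, Nat.cast_ite, Nat.cast_one, Nat.cast_zero]
  refine Eq.trans (by congr) (h.symm.trans (Finset.sum_congr rfl fun π _ => ?_))
  simp only [Γ.constant_on_adj_iff]
  split_ifs <;> simp

/-! ### Bounding the disconnected graphs. -/

/-- A disconnected graph has a nonempty union of components without the last vertex. -/
theorem OrdGraph.exists_closed_of_not_connected {m : ℕ} {d : Fin (m + 1) → ℕ} (Γ : OrdGraph d)
    (hΓ : ¬ Γ.Connected) :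
    ∃ S : Finset (Fin m), S.Nonempty ∧
      ∀ h, decide ((Γ.flip h).1 ∈ S.map Fin.castSuccEmb) =
        decide (h.1 ∈ S.map Fin.castSuccEmb) := by
  classical
  set G := Γ.toSimpleGraph with hG
  have hex : ∃ v, ¬ G.Reachable v (Fin.last m) := by
    by_contra! H
    exact hΓ ((SimpleGraph.connected_iff _).2 ⟨fun a b => (H a).trans (H b).symm, inferInstance⟩)
  obtain ⟨v, hv⟩ := hex
  -- Avoiding the last vertex, whose valency alone grows with the genus, keeps the total valency of
  -- `S` fixed in the limit.
  let S : Finset (Fin m) := Finset.univ.filter fun k => ¬ G.Reachable k.castSucc (Fin.last m)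
  have hS : ∀ k, k ∈ S.map Fin.castSuccEmb ↔ ¬ G.Reachable k (Fin.last m) := by
    intro k
    induction k using Fin.lastCases with
    | last => simp
    | cast k => simp [S]
  refine ⟨S, ?_, ?_⟩
  · rw [← Finset.map_nonempty (f := Fin.castSuccEmb)]
    exact ⟨v, (hS v).2 hv⟩
  · refine (Γ.constant_on_adj_iff fun k => decide (k ∈ S.map Fin.castSuccEmb)).1 ?_
    intro a b hab
    rw [decide_eq_decide, hS, hS]
    exact not_congr ⟨fun h => hab.reachable.symm.trans h, fun h => hab.reachable.trans h⟩

theorem card_closed {m : ℕ} (d : Fin (m + 1) → ℕ) (S : Finset (Fin m)) :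
    Nat.card {Γ : OrdGraph d // ∀ h, decide ((Γ.flip h).1 ∈ S.map Fin.castSuccEmb) =
        decide (h.1 ∈ S.map Fin.castSuccEmb)} =
      matchingCount (∑ k ∈ S, d k.castSucc) *
        matchingCount (∑ k, d k - ∑ k ∈ S, d k.castSucc) := by
  have h1 : ∑ k with k ∈ S.map Fin.castSuccEmb, d k = ∑ k ∈ S, d k.castSucc := by
    rw [Finset.filter_univ_mem, Finset.sum_map]
    rfl
  have h2 := Finset.sum_filter_add_sum_filter_not Finset.univ
    (fun k => k ∈ S.map Fin.castSuccEmb) d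
  rw [OrdGraph.card_fiberwise d fun k => decide (k ∈ S.map Fin.castSuccEmb), Fintype.prod_bool]
  simp only [decide_eq_true_eq, decide_eq_false_iff_not]
  rw [← h2, h1, Nat.add_sub_cancel_left]

-- Union bound: every disconnected graph splits along some `S`, and `card_closed` counts the graphs
-- split by a given `S`.
open scoped Classical in
theorem card_le_card_connected_add {m : ℕ} (d : Fin (m + 1) → ℕ) :
    matchingCount (∑ k, d k) ≤ Nat.card {Γ : OrdGraph d // Γ.Connected} +
      ∑ S : Finset (Fin m) with S.Nonempty, matchingCount (∑ k ∈ S, d k.castSucc) *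
        matchingCount (∑ k, d k - ∑ k ∈ S, d k.castSucc) := by
  simp only [← OrdGraph.card_eq_matchingCount d, ← card_closed, Nat.card_eq_fintype_card,
    Fintype.card_subtype]
  rw [← Finset.card_univ, ← Finset.card_filter_add_card_filter_not (OrdGraph.Connected (d := d))]
  refine Nat.add_le_add_left (le_trans (Finset.card_le_card ?_) Finset.card_biUnion_le) _
  intro Γ hΓ
  obtain ⟨S, hS, h⟩ := Γ.exists_closed_of_not_connected (Finset.mem_filter.1 hΓ).2
  simp only [Finset.mem_biUnion, Finset.mem_filter, Finset.mem_univ, true_and]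
  exact ⟨S, hS, h⟩

/-! ### Asymptotics of the normalized count. -/

theorem matchingCount_two_mul_succ (k : ℕ) :
    matchingCount (2 * (k + 1)) = (2 * k + 1) * matchingCount (2 * k) := by
  rw [matchingCount, matchingCount, if_pos (even_two_mul _), if_pos (even_two_mul _),
    show 2 * (k + 1) - 1 = 2 * k + 1 by omega, Nat.doubleFactorial_add_one]

theorem matchingCount_two_mul_pos (k : ℕ) : 0 < matchingCount (2 * k) := by
  rw [matchingCount, if_pos (even_two_mul _)]
  exact Nat.doubleFactorial_pos _

theorem matchingCount_two_mul_mono : Monotone fun k => matchingCount (2 * k) :=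
  monotone_nat_of_le_succ fun k => by
    rw [matchingCount_two_mul_succ]
    exact Nat.le_mul_of_pos_left _ (by omega)

/-- An even `s ≥ 1` removes at least two points, which costs at least the factor `2k + 1`; for odd
`s` the left side vanishes. -/
theorem matchingCount_mul_le {s : ℕ} (hs : 1 ≤ s) (k : ℕ) :
    (2 * k + 1) * (matchingCount s * matchingCount (2 * (k + 1) - s)) ≤
      matchingCount s * matchingCount (2 * (k + 1)) := by
  by_cases h : Even s
  · obtain ⟨a, rfl⟩ := even_iff_two_dvd.1 h
    have h2 : matchingCount (2 * (k + 1) - 2 * a) ≤ matchingCount (2 * k) := by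
      rw [← Nat.mul_sub]
      exact matchingCount_two_mul_mono (by omega)
    rw [matchingCount_two_mul_succ, mul_left_comm]
    gcongr
  · simp [matchingCount, h]

theorem tendsto_matchingCount_ratio {s : ℕ} (hs : 1 ≤ s) :
    Tendsto (fun N : ℕ => ((matchingCount s * matchingCount (2 * N - s) : ℕ) : ℝ) /
      matchingCount (2 * N)) atTop (𝓝 0) := by
  rw [← tendsto_add_atTop_iff_nat 1]
  have hlim : Tendsto (fun k : ℕ => (matchingCount s : ℝ) / ((2 * k + 1 : ℕ) : ℝ)) atTop (𝓝 0) := by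
    refine Tendsto.div_atTop tendsto_const_nhds (tendsto_natCast_atTop_atTop.comp ?_)
    exact tendsto_atTop_mono (fun k => by simp only [id]; omega) tendsto_id
  refine squeeze_zero (fun k => by positivity) (fun k => ?_) hlim
  have hpos := matchingCount_two_mul_pos (k + 1)
  rw [div_le_div_iff₀ (by exact_mod_cast hpos) (by positivity), mul_comm]
  exact_mod_cast matchingCount_mul_le hs k

/-- The normalized count is the proportion of connected graphs. For `g = 0`, `n = 1` truncated
subtraction gives `0!! = 1`, the conventional `(-1)!!`. -/
theorem ogNormalized_eq {n g : ℕ} {d : Fin n → ℕ} (hn : 1 ≤ n)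
    (hd : ∑ k, d k = 2 * g + 2 * n - 2) :
    ogNormalized g d =
      (Nat.card {Γ : OrdGraph d // Γ.Connected} : ℝ) / matchingCount (2 * g + 2 * n - 2) := by
  have hprod : (0 : ℝ) < ∏ k, ((d k).factorial : ℝ) :=
    Finset.prod_pos fun k _ => Nat.cast_pos.2 (d k).factorial_pos
  have heven : Even (2 * g + 2 * n - 2) := ⟨g + n - 1, by omega⟩
  rw [ogNormalized, og_eq_card_connGraph, card_connGraph hn hd, matchingCount, if_pos heven,
    show 2 * g + 2 * n - 2 - 1 = 2 * g + 2 * n - 3 by omega]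
  field_simp

theorem ogNormalized_le_one {n g : ℕ} {d : Fin n → ℕ} (hn : 1 ≤ n)
    (hd : ∑ k, d k = 2 * g + 2 * n - 2) : ogNormalized g d ≤ 1 := by
  rw [ogNormalized_eq hn hd, ← hd]
  exact div_le_one_of_le₀ (Nat.cast_le.2 (OrdGraph.card_connected_le d)) (Nat.cast_nonneg _)

theorem tendsto_ogNormalized (m : ℕ) (i : Fin m → ℕ) (hi : ∀ k, 1 ≤ i k) :
    Tendsto
      (fun g : ℕ => ogNormalized g
        (Fin.snoc (α := fun _ => ℕ) i (2 * g + 2 * (m + 1) - 2 - ∑ k, i k)))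
      atTop (𝓝 1) := by
  classical
  have hlow : Tendsto (fun g : ℕ => 1 - ∑ S : Finset (Fin m) with S.Nonempty,
      ((matchingCount (∑ k ∈ S, i k) * matchingCount (2 * (g + m) - ∑ k ∈ S, i k) : ℕ) : ℝ) /
        matchingCount (2 * (g + m))) atTop (𝓝 1) := by
    have h : Tendsto (fun g : ℕ => ∑ S : Finset (Fin m) with S.Nonempty,
      ((matchingCount (∑ k ∈ S, i k) * matchingCount (2 * (g + m) - ∑ k ∈ S, i k) : ℕ) : ℝ) /
        matchingCount (2 * (g + m))) atTop
        (𝓝 (∑ S : Finset (Fin m) with S.Nonempty, (0 : ℝ))) := by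
      refine tendsto_finsetSum _ fun S hS => ?_
      obtain ⟨k, hk⟩ := (Finset.mem_filter.1 hS).2
      have hs : 1 ≤ ∑ k ∈ S, i k := (hi k).trans (Finset.single_le_sum (by simp) hk)
      exact (tendsto_matchingCount_ratio hs).comp (tendsto_add_atTop_nat m)
    simpa using h.const_sub 1
  -- For small `g` the last valency may be truncated to 0, spoiling the valency sum; this bound
  -- rules that out.
  have hev : ∀ᶠ g : ℕ in atTop, ∑ k, i k ≤ 2 * g :=
    (eventually_ge_atTop (∑ k, i k)).mono fun g hg => by omega
  have hsum : ∀ g : ℕ, ∑ k, i k ≤ 2 * g →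
      ∑ k, (Fin.snoc (α := fun _ => ℕ) i (2 * g + 2 * (m + 1) - 2 - ∑ k, i k) :
        Fin (m + 1) → ℕ) k = 2 * g + 2 * (m + 1) - 2 := by
    intro g hg
    rw [Fin.sum_univ_castSucc]
    simp only [Fin.snoc_castSucc, Fin.snoc_last]
    omega
  refine tendsto_of_tendsto_of_tendsto_of_le_of_le' hlow tendsto_const_nhds ?_ ?_
  · filter_upwards [hev] with g hg
    have h := card_le_card_connected_add
      (Fin.snoc (α := fun _ => ℕ) i (2 * g + 2 * (m + 1) - 2 - ∑ k, i k))
    rw [ogNormalized_eq (by omega) (hsum g hg)]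
    simp only [hsum g hg, Fin.snoc_castSucc] at h
    rw [show 2 * g + 2 * (m + 1) - 2 = 2 * (g + m) by omega] at h ⊢
    have hpos : (0 : ℝ) < matchingCount (2 * (g + m)) :=
      Nat.cast_pos.2 (matchingCount_two_mul_pos _)
    rw [← Finset.sum_div, sub_le_iff_le_add, ← add_div, one_le_div hpos]
    exact_mod_cast h
  · filter_upwards [hev] with g hg
    exact ogNormalized_le_one (by omega) (hsum g hg)

end OrdinaryGraphs

open OrdinaryGraphs in
/-- The number of vertices is `n = m + 1`; the valencies of the first `m` vertices are fixed. -/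
theorem mainTheorem1 (m : ℕ) (i : Fin m → ℕ) (hi : ∀ k, 1 ≤ i k) :
    Tendsto
      (fun g : ℕ => ogNormalized g
        (Fin.snoc (α := fun _ => ℕ) i (2 * g + 2 * (m + 1) - 2 - ∑ k, i k)))
      atTop (𝓝 1) ∧
    ∀ (g : ℕ) (d : Fin (m + 1) → ℕ), (∀ k, 1 ≤ d k) →
      ∑ k, d k = 2 * g + 2 * (m + 1) - 2 →
      og g d = 1 / ((∏ k, ((d k).factorial : ℝ)) * ((m + 1).factorial : ℝ)) *
        gueCorrelator 1 d := by
  refine ⟨tendsto_ogNormalized m i hi, fun g d _ hsum => ?_⟩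
  rw [og_eq_card_connGraph, card_connGraph (by omega) hsum,
    card_connected_eq_gueCorrelator (by omega), one_div, div_eq_inv_mul]
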